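/- Let $\mathcal{W}=W(2,2)$ be the complex Lie algebra with basis $\{L_n,W_n,z\mid n\in\mathbb{Z}\}$ and brackets $[L_n,L_m]=(m-n)L_{m+n}+\frac{n^3-n}{12}\delta_{m+n,0}\,z$, $[L_n,W_m]=(m-n)W_{m+n}+\frac{n^3-n}{12}\delta_{m+n,0}\,z$, $[W_n,W_m]=[z,W_m]=[z,L_m]=0$, and let $\mathcal{W}_+$ be the subalgebra spanned by the $L_n,W_n$ with $n>0$. Let $\varphi:\mathcal{W}_+\to\mathbb{C}$ be a Lie algebra homomorphism that is non-singular, i.e. $\varphi(L_i)\varphi(W_i)\neq 0$ for $i=1,2$. For a $\mathcal{W}$-module $V$, let $Wh(V)=\{v\in V\mid xv=\varphi(x)v \text{ for all } x\in\mathcal{W}_+\}$ be the set of Whittaker vectors (including $0$). A Whittaker vector that generates $V$ as a $\mathcal{W}$-module is called a cyclic Whittaker vector, and $V$ is a Whittaker module of type $\varphi$ if it has one (so the zero module, generated by the vector $0$, counts as one). Let $S(z)=\mathbb{C}[z]$ be the algebra of polynomials in $z$, acting on every $\mathcal{W}$-module. A module is indecomposable if it is nonzero and is not the direct sum of two nonzero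 submodules. Let $V$ be a Whittaker module of type $\varphi$. Then: 1) there are finitely many submodules $V_1,\dots,V_r$ of $V$, each of them an indecomposable Whittaker module of type $\varphi$, such that $V=\bigoplus_{i=1}^r V_i$ (with $r=0$ if $V=0$); 2) if $w$ is any cyclic Whittaker vector of $V$, then $Wh(V)=S(z)w$, and every submodule of $V$ is a Whittaker module of type $\varphi$ generated by a vector in $Wh(V)=S(z)w$. -/

import Mathlib

noncomputable section

namespace W22

/-- Names of the basis vectors `L n`, `W n` (`n ∈ ℤ`) and `z` of the algebra `W(2,2)`. -/
inductive Gen : Type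
  | L : ℤ → Gen
  | W : ℤ → Gen
  | z : Gen

/-- The underlying vector space of `W(2,2)`: the complex vector space with basis
`L n`, `W n` (`n ∈ ℤ`) and `z`. -/
def Alg : Type := Gen →₀ ℂ

instance : AddCommGroup Alg := inferInstanceAs (AddCommGroup (Gen →₀ ℂ))

instance : Module ℂ Alg := inferInstanceAs (Module ℂ (Gen →₀ ℂ))

/-- The basis of `W(2,2)` given by the generators. -/
def basis : Module.Basis Gen ℂ Alg := Module.Basis.ofRepr (LinearEquiv.refl ℂ (Gen →₀ ℂ))

/-- The element `L n` of `W(2,2)`. -/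
def L (n : ℤ) : Alg := basis (Gen.L n)

/-- The element `W n` of `W(2,2)`. -/
def W (n : ℤ) : Alg := basis (Gen.W n)

/-- The central element `z` of `W(2,2)`. -/
def z : Alg := basis Gen.z

/-- The central term `(n³ - n) / 12 · δ_{m+n,0} z`. -/
def central (n m : ℤ) : Alg :=
  if m + n = 0 then (((n : ℂ) ^ 3 - (n : ℂ)) / 12) • z else 0

/-- The bracket on basis vectors:
`[L n, L m] = (m - n) L (m + n) + (n³ - n) / 12 · δ_{m+n,0} z`,
`[L n, W m] = (m - n) W (m + n) + (n³ - n) / 12 · δ_{m+n,0} z`,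
`[W n, L m] = - [L m, W n]`, and all other brackets are zero. -/
def genBracket : Gen → Gen → Alg
  | Gen.L n, Gen.L m => ((m : ℂ) - (n : ℂ)) • L (m + n) + central n m
  | Gen.L n, Gen.W m => ((m : ℂ) - (n : ℂ)) • W (m + n) + central n m
  | Gen.W n, Gen.L m => -(((n : ℂ) - (m : ℂ)) • W (n + m) + central m n)
  | _, _ => 0

/-- The bilinear extension of the bracket on basis vectors. -/
def bracketHom : Alg →ₗ[ℂ] Alg →ₗ[ℂ] Alg :=
  basis.constr ℂ fun a => basis.constr ℂ fun b => genBracket a b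

instance : Bracket Alg Alg := ⟨fun x y => bracketHom x y⟩

theorem bracket_def (x y : Alg) : ⁅x, y⁆ = bracketHom x y := rfl

theorem bracketHom_basis (a b : Gen) : bracketHom (basis a) (basis b) = genBracket a b := by
  simp [bracketHom]

theorem lie_LL (n m : ℤ) :
    ⁅L n, L m⁆ = ((m : ℂ) - (n : ℂ)) • L (m + n) + central n m :=
  bracketHom_basis _ _

theorem lie_LW (n m : ℤ) :
    ⁅L n, W m⁆ = ((m : ℂ) - (n : ℂ)) • W (m + n) + central n m :=
  bracketHom_basis _ _

theorem lie_WL (n m : ℤ) :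
    ⁅W n, L m⁆ = -(((n : ℂ) - (m : ℂ)) • W (n + m) + central m n) :=
  bracketHom_basis _ _

theorem lie_WW (n m : ℤ) : ⁅W n, W m⁆ = 0 := bracketHom_basis _ _

theorem bracketHom_z_right (x : Alg) : bracketHom x z = 0 := by
  have h : bracketHom.flip z = 0 := by
    refine basis.ext fun a => ?_
    cases a <;> simp [z, bracketHom_basis, genBracket]
  simpa using LinearMap.congr_fun h x

theorem bracketHom_z_left (x : Alg) : bracketHom z x = 0 := by
  have h : bracketHom z = 0 := by
    refine basis.ext fun a => ?_
    cases a <;> simp [z, bracketHom_basis, genBracket]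
  simpa using LinearMap.congr_fun h x

theorem bracketHom_central_right (x : Alg) (n m : ℤ) : bracketHom x (central n m) = 0 := by
  unfold central
  split_ifs <;> simp [bracketHom_z_right]

theorem bracketHom_central_left (x : Alg) (n m : ℤ) : bracketHom (central n m) x = 0 := by
  unfold central
  split_ifs <;> simp [bracketHom_z_left]

theorem bracketHom_skew (x y : Alg) : bracketHom x y = -bracketHom y x := by
  have h : bracketHom = -bracketHom.flip := by
    refine basis.ext fun a => basis.ext fun b => ?_
    simp only [LinearMap.neg_apply, LinearMap.flip_apply, bracketHom_basis]
    rcases a with n | n | _ <;> rcases b with m | m | _ <;>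
      simp only [genBracket, neg_neg, neg_zero]
    rw [add_comm n m]
    by_cases hmn : m + n = 0
    · obtain rfl : m = -n := by omega
      simp only [central]
      simp
      module
    · simp only [central, hmn, add_comm n m, if_false]
      module
  exact LinearMap.congr_fun (LinearMap.congr_fun h x) y

theorem bracketHom_jacobi (x y w : Alg) :
    bracketHom x (bracketHom y w) =
      bracketHom (bracketHom x y) w + bracketHom y (bracketHom x w) := by
  have hLL : ∀ n m, bracketHom (L n) (L m) = ((m : ℂ) - (n : ℂ)) • L (m + n) + central n m := lie_LL
  have hLW : ∀ n m, bracketHom (L n) (W m) = ((m : ℂ) - (n : ℂ)) • W (m + n) + central n m := lie_LW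
  have hWL : ∀ n m, bracketHom (W n) (L m) =
      -(((n : ℂ) - (m : ℂ)) • W (n + m) + central m n) := lie_WL
  have hWW : ∀ n m, bracketHom (W n) (W m) = 0 := lie_WW
  have key : ∀ a b c : Gen, bracketHom (basis a) (bracketHom (basis b) (basis c)) =
      bracketHom (bracketHom (basis a) (basis b)) (basis c) +
        bracketHom (basis b) (bracketHom (basis a) (basis c)) := by
    intro a b c
    have eL : ∀ n, basis (Gen.L n) = L n := fun _ => rfl
    have eW : ∀ n, basis (Gen.W n) = W n := fun _ => rfl
    have ez : basis Gen.z = z := rfl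
    rcases a with n | n | _ <;> rcases b with m | m | _ <;> rcases c with k | k | _ <;>
      simp only [eL, eW, ez, hLL, hLW, hWL, hWW, bracketHom_z_left, bracketHom_z_right,
        bracketHom_central_left, bracketHom_central_right, map_add, map_smul, map_neg, map_zero,
        LinearMap.add_apply, LinearMap.smul_apply, LinearMap.neg_apply, LinearMap.zero_apply,
        smul_zero, add_zero, neg_zero]
    all_goals
      have e (p q r : ℤ) : p + (q + r) = p + q + r := (add_assoc p q r).symm
      have e₁ : n + k + m = n + m + k := by ring
      have e₂ : m + n + k = n + m + k := by ring
      have e₃ : m + k + n = n + m + k := by ring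
      have e₄ : k + n + m = n + m + k := by ring
      have e₅ : k + m + n = n + m + k := by ring
      simp only [central, e, e₁, e₂, e₃, e₄, e₅]
      by_cases h : n + m + k = 0
      · obtain rfl : k = -n - m := by omega
        simp only [h, if_true]
        push_cast
        module
      · simp only [h, if_false]
        push_cast
        module
  have step₁ : ∀ (b c : Gen) (x : Alg), bracketHom x (bracketHom (basis b) (basis c)) =
      bracketHom (bracketHom x (basis b)) (basis c) +
        bracketHom (basis b) (bracketHom x (basis c)) := by
    intro b c x
    refine LinearMap.congr_fun (f := bracketHom.flip (bracketHom (basis b) (basis c)))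
      (g := bracketHom.flip (basis c) ∘ₗ bracketHom.flip (basis b) +
        bracketHom (basis b) ∘ₗ bracketHom.flip (basis c)) (basis.ext fun a => ?_) x
    exact key a b c
  have step₂ : ∀ (c : Gen) (x y : Alg), bracketHom x (bracketHom y (basis c)) =
      bracketHom (bracketHom x y) (basis c) + bracketHom y (bracketHom x (basis c)) := by
    intro c x y
    refine LinearMap.congr_fun (f := bracketHom x ∘ₗ bracketHom.flip (basis c))
      (g := bracketHom.flip (basis c) ∘ₗ bracketHom x +
        bracketHom.flip (bracketHom x (basis c))) (basis.ext fun b => ?_) y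
    exact step₁ b c x
  refine LinearMap.congr_fun (f := bracketHom x ∘ₗ bracketHom y)
    (g := bracketHom (bracketHom x y) + bracketHom y ∘ₗ bracketHom x) (basis.ext fun c => ?_) w
  exact step₂ c x y

instance : LieRing Alg where
  add_lie x y w := by simp [bracket_def]
  lie_add x y w := by simp [bracket_def]
  lie_self x := by
    have h : bracketHom x x = -bracketHom x x := bracketHom_skew x x
    have h₂ : (2 : ℂ) • bracketHom x x = 0 := by
      rw [two_smul]
      nth_rewrite 2 [h]
      exact add_neg_cancel _
    exact (smul_eq_zero.mp h₂).resolve_left two_ne_zero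
  leibniz_lie x y w := bracketHom_jacobi x y w

instance : LieAlgebra ℂ Alg where
  lie_smul t x y := by simp [bracket_def]

/-- The subalgebra `W(2,2)₊`, spanned by the `L n` and `W n` with `n > 0`. -/
def plus : LieSubalgebra ℂ Alg where
  __ := Submodule.span ℂ {x : Alg | ∃ n : ℤ, 0 < n ∧ (x = L n ∨ x = W n)}
  lie_mem' {x y} hx hy := by
    have mL : ∀ n : ℤ, 0 < n →
        L n ∈ Submodule.span ℂ {x : Alg | ∃ n : ℤ, 0 < n ∧ (x = L n ∨ x = W n)} :=
      fun n hn => Submodule.subset_span ⟨n, hn, Or.inl rfl⟩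
    have mW : ∀ n : ℤ, 0 < n →
        W n ∈ Submodule.span ℂ {x : Alg | ∃ n : ℤ, 0 < n ∧ (x = L n ∨ x = W n)} :=
      fun n hn => Submodule.subset_span ⟨n, hn, Or.inr rfl⟩
    have hc : ∀ n m : ℤ, 0 < n → 0 < m → central n m = 0 := by
      intro n m hn hm
      simp only [central, show ¬ (m + n = 0) by omega, if_false]
    change ⁅x, y⁆ ∈ Submodule.span ℂ {x : Alg | ∃ n : ℤ, 0 < n ∧ (x = L n ∨ x = W n)}
    change x ∈ Submodule.span ℂ {x : Alg | ∃ n : ℤ, 0 < n ∧ (x = L n ∨ x = W n)} at hx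
    change y ∈ Submodule.span ℂ {x : Alg | ∃ n : ℤ, 0 < n ∧ (x = L n ∨ x = W n)} at hy
    induction hx using Submodule.span_induction with
    | zero => rw [zero_lie]; exact Submodule.zero_mem _
    | add a b _ _ ha hb => rw [add_lie]; exact Submodule.add_mem _ ha hb
    | smul t a _ ha => rw [smul_lie]; exact Submodule.smul_mem _ t ha
    | mem a ha =>
      obtain ⟨n, hn, ha⟩ := ha
      induction hy using Submodule.span_induction with
      | zero => rw [lie_zero]; exact Submodule.zero_mem _
      | add b c _ _ hb hc => rw [lie_add]; exact Submodule.add_mem _ hb hc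
      | smul t b _ hb => rw [lie_smul]; exact Submodule.smul_mem _ t hb
      | mem b hb =>
        obtain ⟨m, hm, hb⟩ := hb
        rcases ha with rfl | rfl <;> rcases hb with rfl | rfl
        · rw [lie_LL, hc n m hn hm, add_zero]
          exact Submodule.smul_mem _ _ (mL _ (add_pos hm hn))
        · rw [lie_LW, hc n m hn hm, add_zero]
          exact Submodule.smul_mem _ _ (mW _ (add_pos hm hn))
        · rw [lie_WL, hc m n hm hn, add_zero]
          exact Submodule.neg_mem _ (Submodule.smul_mem _ _ (mW _ (add_pos hn hm)))
        · rw [lie_WW]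
          exact Submodule.zero_mem _

theorem L_mem_plus {n : ℤ} (hn : 0 < n) : L n ∈ plus :=
  Submodule.subset_span ⟨n, hn, Or.inl rfl⟩

theorem W_mem_plus {n : ℤ} (hn : 0 < n) : W n ∈ plus :=
  Submodule.subset_span ⟨n, hn, Or.inr rfl⟩

/-- `L n` for `n > 0`, as an element of `W(2,2)₊`. -/
def plusL (n : ℤ) (hn : 0 < n) : plus := ⟨L n, L_mem_plus hn⟩

/-- `W n` for `n > 0`, as an element of `W(2,2)₊`. -/
def plusW (n : ℤ) (hn : 0 < n) : plus := ⟨W n, W_mem_plus hn⟩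

/-- A Lie algebra homomorphism `φ : W(2,2)₊ → ℂ` is non-singular if its values at
`L 1`, `W 1`, `L 2`, `W 2` are all nonzero. -/
def NonSingular (φ : LieAlgebra.LieCharacter ℂ plus) : Prop :=
  φ (plusL 1 one_pos) * φ (plusW 1 one_pos) ≠ 0 ∧
    φ (plusL 2 two_pos) * φ (plusW 2 two_pos) ≠ 0

section Modules

variable (φ : LieAlgebra.LieCharacter ℂ plus) (V : Type*) [AddCommGroup V] [Module ℂ V]
  [LieRingModule Alg V] [LieModule ℂ Alg V]

/-- `Wh(V)`: the space of Whittaker vectors of type `φ` in `V` (including `0`). -/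
def Wh : Submodule ℂ V where
  carrier := {v | ∀ x : plus, ⁅(x : Alg), v⁆ = φ x • v}
  zero_mem' x := by rw [lie_zero, smul_zero]
  add_mem' {v w} hv hw x := by rw [lie_add, hv x, hw x, smul_add]
  smul_mem' c v hv x := by rw [lie_smul, hv x, smul_comm]

variable {V}

/-- `v` is a cyclic Whittaker vector of type `φ`: it is a Whittaker vector and it generates `V`
as a module over `W(2,2)`. -/
def IsCyclicWhittakerVector (v : V) : Prop :=
  v ∈ Wh φ V ∧ LieSubmodule.lieSpan ℂ Alg {v} = ⊤

variable (V)

/-- `V` is a Whittaker module of type `φ`. -/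
def IsWhittakerModule : Prop := ∃ v : V, IsCyclicWhittakerVector φ v

/-- `V` is indecomposable: it is nonzero, and it is not the direct sum of two nonzero
submodules. -/
def IsIndecomposable : Prop :=
  Nontrivial V ∧ ∀ A B : LieSubmodule ℂ Alg V, IsCompl A B → A = ⊥ ∨ B = ⊥

variable {V}

/-- `S(z) w`: all vectors `p(z) w`, where `p` is a polynomial in the action of `z` on `V`. -/
def polyOrbit (w : V) : Set V :=
  Set.range fun p : Polynomial ℂ => Polynomial.aeval (LieModule.toEnd ℂ Alg V z) p w

end Modules

end W22

end

/-! Everything rests on two facts: the Whittaker vectors of a cyclic module are the multiples `p(z)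
w`, and every nonzero submodule contains a nonzero one. Both come from lowering operators, not from
a PBW basis. The arguments therefore need no freeness and apply to any cyclic Whittaker module, in
particular to quotients.

A character kills brackets, so `φ (W n) = 0` for `n ≥ 3`, while `φ (W 2) ≠ 0`. Write `V` as the sums
of products of `L (-k)` applied to `polyW w`, which consists of sums of products of `W (-k)` applied
to `S(z) w`. The operators `W n - φ (W n)` lower the degree in the `L (-k)`. After a triangular
correction they become partial derivatives modulo lower degree (`exists_partialDeriv`), and Euler's
identity forces their common kernel into `polyW w` (`mem_polyW_of_shiftW_eq_zero`). On `polyW w` the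
operators `L (K+2) - φ (L (K+2))` likewise strip off the variables `W (-K)`, which leaves `S(z) w`
(`mem_zOrbit_of_shiftL_eq_zero`). Applying the same operators inside a submodule, and stopping just
before zero, gives `exists_zOrbit_mem_of_ne_bot`.

The rest is the theory of `ℂ[X]`. For a submodule `N`, the ideal of all `p` with `p(z) w ∈ N` has a
generator `g`. If `g(z) w` failed to generate `N`, the second fact in the quotient by its span would
give a `p` in that ideal not divisible by `g` (`exists_eq_lieSpan`). If no nonzero polynomial in `z`
kills `w`, then `V` is indecomposable because `ℂ[X]` is a domain. Otherwise `V` is the finite sum of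
its generalized eigenspaces for `z`, each of which is zero or is indecomposable because `ℂ[X]/(X -
ξ)^k` is local. -/

noncomputable section

namespace W22

/-! ### Filtrations by number of operators, and the Weyl algebra relation `[E, X] = c`. -/

section Filtration

variable {ι V : Type*} [AddCommGroup V] [Module ℂ V]

/-- The sums of products of fewer than `s` of the operators `X i`, applied to vectors of `A`. -/
def filt (A : Submodule ℂ V) (X : ι → Module.End ℂ V) : ℕ → Submodule ℂ V
  | 0 => ⊥
  | s + 1 => A ⊔ ⨆ i, (filt A X s).map (X i)

variable {A : Submodule ℂ V} {X : ι → Module.End ℂ V}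

theorem le_filt_succ (s : ℕ) : A ≤ filt A X (s + 1) := le_sup_left

theorem apply_mem_filt_succ {s : ℕ} {u : V} (hu : u ∈ filt A X s) (i : ι) :
    X i u ∈ filt A X (s + 1) :=
  le_sup_right (a := A) (Submodule.mem_iSup_of_mem i (Submodule.mem_map_of_mem hu))

theorem filt_succ_le {s : ℕ} {P : Submodule ℂ V} (hA : A ≤ P)
    (h : ∀ i, ∀ u ∈ filt A X s, X i u ∈ P) : filt A X (s + 1) ≤ P := by
  refine sup_le hA (iSup_le fun i => ?_)
  rintro _ ⟨u, hu, rfl⟩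
  exact h i u hu

theorem filt_le_succ (s : ℕ) : filt A X s ≤ filt A X (s + 1) := by
  induction s with
  | zero => exact bot_le
  | succ s ih =>
    exact filt_succ_le (le_filt_succ _) fun i u hu => apply_mem_filt_succ (ih hu) i

theorem filt_mono : Monotone (filt A X) := monotone_nat_of_le_succ filt_le_succ

theorem filt_one : filt A X 1 = A := by
  simp [filt]

theorem mem_iSup_filt {v : V} : v ∈ ⨆ s, filt A X s ↔ ∃ s, v ∈ filt A X s :=
  Submodule.mem_iSup_of_directed _ filt_mono.directed_le

theorem apply_mem_iSup_filt {v : V} (hv : v ∈ ⨆ s, filt A X s) (i : ι) :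
    X i v ∈ ⨆ s, filt A X s := by
  obtain ⟨s, hs⟩ := mem_iSup_filt.1 hv
  exact mem_iSup_filt.2 ⟨s + 1, apply_mem_filt_succ hs i⟩

/-- If `[E, X] = c` and `E` kills `A`, then `E` lowers the filtration by powers of `X`. -/
theorem lower_filt {c : ℂ} {X E : Module.End ℂ V} (hA : ∀ v ∈ A, E v = 0)
    (hEX : ∀ v ∈ ⨆ s, filt A (fun _ : Unit => X) s, E (X v) = X (E v) + c • v) (s : ℕ) :
    ∀ v ∈ filt A (fun _ : Unit => X) (s + 1), E v ∈ filt A (fun _ : Unit => X) s := by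
  induction s with
  | zero =>
    intro v hv
    rw [zero_add, filt_one] at hv
    rw [hA v hv]
    exact zero_mem _
  | succ s ih =>
    suffices h : filt A (fun _ : Unit => X) (s + 1 + 1) ≤
        (filt A (fun _ : Unit => X) (s + 1)).comap E from fun v hv => h hv
    refine filt_succ_le (fun v hv => ?_) fun i u hu => ?_
    · rw [Submodule.mem_comap, hA v hv]
      exact zero_mem _
    · rw [Submodule.mem_comap, hEX u (mem_iSup_filt.2 ⟨_, hu⟩)]
      exact add_mem (apply_mem_filt_succ (X := fun _ : Unit => X) (ih u hu) ())
        (Submodule.smul_mem _ _ hu)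

/-- If `[E, X] = c ≠ 0` and `E` kills `A`, then the kernel of `E` on `∑ Xˢ A` is `A`. -/
theorem mem_of_lower_eq_zero {c : ℂ} (hc : c ≠ 0) {X E : Module.End ℂ V} (hA : ∀ v ∈ A, E v = 0)
    (hEX : ∀ v ∈ ⨆ s, filt A (fun _ : Unit => X) s, E (X v) = X (E v) + c • v) {v : V}
    (hv : v ∈ ⨆ s, filt A (fun _ : Unit => X) s) (hE : E v = 0) : v ∈ A := by
  -- `E` behaves as `c · d/dX`, so `X E` is `c` times the Euler operator. It acts as `c s` on the
  -- top degree, which is `s` because `filt (s + 1)` allows at most `s` factors. When `E v = 0`,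
  -- this pushes `v` down one degree as long as `s ≠ 0`.
  have euler : ∀ s, ∀ v ∈ filt A (fun _ : Unit => X) (s + 1),
      X (E v) - (c * s) • v ∈ filt A (fun _ : Unit => X) s := by
    intro s
    induction s with
    | zero =>
      intro v hv
      rw [zero_add, filt_one] at hv
      simp [hA v hv]
    | succ s ih =>
      suffices h : filt A (fun _ : Unit => X) (s + 1 + 1) ≤
          (filt A (fun _ : Unit => X) (s + 1)).comap
            (X ∘ₗ E - (c * ((s + 1 : ℕ) : ℂ)) • LinearMap.id) from fun v hv => h hv
      refine filt_succ_le (fun v hv => ?_) fun i u hu => ?_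
      · simp only [Submodule.mem_comap, LinearMap.sub_apply, LinearMap.comp_apply, hA v hv,
          map_zero, LinearMap.smul_apply, LinearMap.id_apply]
        exact sub_mem (zero_mem _) (Submodule.smul_mem _ _ (le_filt_succ _ hv))
      · have h := apply_mem_filt_succ (X := fun _ : Unit => X) (ih u hu) ()
        simp only [Submodule.mem_comap, LinearMap.sub_apply, LinearMap.comp_apply,
          LinearMap.smul_apply, LinearMap.id_apply, hEX u (mem_iSup_filt.2 ⟨_, hu⟩)]
        convert h using 1
        simp only [map_add, map_sub, map_smul]
        push_cast
        module
  have down : ∀ s, v ∈ filt A (fun _ : Unit => X) (s + 1) → v ∈ A := by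
    intro s
    induction s with
    | zero =>
      intro hv
      rwa [zero_add, filt_one] at hv
    | succ s ih =>
      intro hv
      apply ih
      have h := euler _ v hv
      rw [hE, map_zero, zero_sub, neg_mem_iff] at h
      exact (Submodule.smul_mem_iff _ (mul_ne_zero hc (by exact_mod_cast s.succ_ne_zero))).1 h
  obtain ⟨s, hs⟩ := mem_iSup_filt.1 hv
  exact down s (filt_le_succ s hs)

end Filtration

/-! ### Values of the character, and the abelian ideal spanned by `z` and the `W n`. -/

section Character

variable (φ : LieAlgebra.LieCharacter ℂ plus)

/-- The value `φ (L n)`, for `n > 0`. -/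
def charL (n : ℤ) : ℂ := if h : 0 < n then φ (plusL n h) else 0

/-- The value `φ (W n)`, for `n > 0`. -/
def charW (n : ℤ) : ℂ := if h : 0 < n then φ (plusW n h) else 0

/-- A character vanishes on brackets, and `[L 1, W (n - 1)]` is `W n` times `n - 2`, which is
nonzero. -/
theorem charW_eq_zero {n : ℤ} (hn : 3 ≤ n) : charW φ n = 0 := by
  have h1 : 0 < n := by omega
  have h2 : 0 < n - 1 := by omega
  have h : ⁅plusL 1 one_pos, plusW (n - 1) h2⁆ = ((n : ℂ) - 2) • plusW n h1 := by
    apply Subtype.ext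
    change ⁅L 1, W (n - 1)⁆ = ((n : ℂ) - 2) • W n
    rw [lie_LW, central, if_neg (by omega), add_zero, sub_add_cancel]
    push_cast
    congr 1
    ring
  have h' := LieAlgebra.lieCharacter_apply_lie φ (plusL 1 one_pos) (plusW (n - 1) h2)
  rw [h, map_smul, smul_eq_mul, mul_eq_zero] at h'
  rw [charW, dif_pos h1]
  refine h'.resolve_left fun h0 => ?_
  have : (n : ℂ) = ((2 : ℤ) : ℂ) := by
    push_cast
    linear_combination h0
  have := Int.cast_injective this
  omega

theorem charW_two_ne_zero (hφ : NonSingular φ) : charW φ 2 ≠ 0 := by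
  rw [charW, dif_pos two_pos]
  exact right_ne_zero_of_mul hφ.2

end Character

/-- The span of `z` and the `W n`. -/
def spanW : Submodule ℂ Alg := Submodule.span ℂ (insert z (Set.range W))

theorem z_mem_spanW : z ∈ spanW := Submodule.subset_span (Set.mem_insert _ _)

theorem W_mem_spanW (n : ℤ) : W n ∈ spanW :=
  Submodule.subset_span (Set.mem_insert_of_mem _ ⟨n, rfl⟩)

theorem central_mem_spanW (n m : ℤ) : central n m ∈ spanW := by
  unfold central
  split_ifs
  exacts [Submodule.smul_mem _ _ z_mem_spanW, zero_mem _]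

theorem lie_z_right (x : Alg) : ⁅x, z⁆ = 0 := bracketHom_z_right x

theorem lie_L_mem_spanW (n : ℤ) {x : Alg} (hx : x ∈ spanW) : ⁅L n, x⁆ ∈ spanW := by
  induction hx using Submodule.span_induction with
  | zero => simp
  | add a b _ _ ha hb => rw [lie_add]; exact add_mem ha hb
  | smul t a _ ha => rw [lie_smul]; exact Submodule.smul_mem _ _ ha
  | mem a ha =>
    rcases ha with rfl | ⟨m, rfl⟩
    · rw [lie_z_right]
      exact zero_mem _
    · rw [lie_LW]
      exact add_mem (Submodule.smul_mem _ _ (W_mem_spanW _)) (central_mem_spanW _ _)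

theorem lie_z_comm (x : Alg) {V : Type*} [AddCommGroup V] [LieRingModule Alg V]
    (v : V) : ⁅x, ⁅z, v⁆⁆ = ⁅z, ⁅x, v⁆⁆ := by
  rw [leibniz_lie, lie_z_right, zero_lie, zero_add]

theorem lie_W_comm (m n : ℤ) {V : Type*} [AddCommGroup V] [LieRingModule Alg V]
    (v : V) : ⁅W m, ⁅W n, v⁆⁆ = ⁅W n, ⁅W m, v⁆⁆ := by
  rw [leibniz_lie, lie_WW, zero_lie, zero_add]

/-! ### Whittaker vectors, and the subspace `polyW w` generated from `S(z) w` by the `W (-k)`. -/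

section Modules

variable {φ : LieAlgebra.LieCharacter ℂ plus} {V : Type*} [AddCommGroup V] [Module ℂ V]
  [LieRingModule Alg V] [LieModule ℂ Alg V]

theorem lie_L_of_mem_Wh {v : V} (hv : v ∈ Wh φ V) {n : ℤ} (hn : 0 < n) :
    ⁅L n, v⁆ = charL φ n • v := by
  rw [charL, dif_pos hn]
  exact hv (plusL n hn)

theorem lie_W_of_mem_Wh {v : V} (hv : v ∈ Wh φ V) {n : ℤ} (hn : 0 < n) :
    ⁅W n, v⁆ = charW φ n • v := by
  rw [charW, dif_pos hn]
  exact hv (plusW n hn)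

theorem lie_aeval_z (x : Alg) (p : Polynomial ℂ) (v : V) :
    ⁅x, Polynomial.aeval (LieModule.toEnd ℂ Alg V z) p v⁆ =
      Polynomial.aeval (LieModule.toEnd ℂ Alg V z) p ⁅x, v⁆ := by
  have h : Commute (LieModule.toEnd ℂ Alg V x) (LieModule.toEnd ℂ Alg V z) :=
    LinearMap.ext fun v => lie_z_comm x v
  have h' : Commute (LieModule.toEnd ℂ Alg V x)
      (Polynomial.aeval (LieModule.toEnd ℂ Alg V z) p) := by
    induction p using Polynomial.induction_on' with
    | add p q hp hq => rw [map_add]; exact hp.add_right hq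
    | monomial n a =>
      rw [Polynomial.aeval_monomial]
      exact (Algebra.commute_algebraMap_right a _).mul_right (h.pow_right n)
  exact LinearMap.congr_fun h'.eq v

/-- `S(z) w`, as a subspace. -/
def zOrbit (w : V) : Submodule ℂ V :=
  LinearMap.range (LinearMap.applyₗ w ∘ₗ
    (Polynomial.aeval (LieModule.toEnd ℂ Alg V z)).toLinearMap)

theorem mem_zOrbit {w v : V} :
    v ∈ zOrbit w ↔ ∃ p : Polynomial ℂ, Polynomial.aeval (LieModule.toEnd ℂ Alg V z) p w = v :=
  Iff.rfl

theorem coe_zOrbit (w : V) : (zOrbit w : Set V) = polyOrbit w := rfl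

theorem self_mem_zOrbit (w : V) : w ∈ zOrbit w := mem_zOrbit.2 ⟨1, by simp⟩

theorem lie_z_mem_zOrbit {w v : V} (hv : v ∈ zOrbit w) : ⁅z, v⁆ ∈ zOrbit w := by
  obtain ⟨p, rfl⟩ := mem_zOrbit.1 hv
  exact mem_zOrbit.2 ⟨Polynomial.X * p, by simp⟩

theorem zOrbit_le_Wh {w : V} (hw : w ∈ Wh φ V) : zOrbit w ≤ Wh φ V := by
  intro v hv x
  obtain ⟨p, rfl⟩ := mem_zOrbit.1 hv
  rw [lie_aeval_z, hw x, map_smul]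

/-- The sums of products of `W (-k)`, `k < K`, applied to vectors of `S(z) w`. -/
def polyWBelow (w : V) : ℕ → Submodule ℂ V
  | 0 => zOrbit w
  | K + 1 => ⨆ s, filt (polyWBelow w K) (fun _ : Unit => LieModule.toEnd ℂ Alg V (W (-K))) s

/-- The sums of products of `W (-k)`, `k ≥ 0`, applied to vectors of `S(z) w`. -/
def polyW (w : V) : Submodule ℂ V := ⨆ K, polyWBelow w K

theorem polyWBelow_mono (w : V) : Monotone (polyWBelow w) :=
  monotone_nat_of_le_succ fun K =>
    filt_one.ge.trans (le_iSup (filt (polyWBelow w K) _) 1)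

theorem mem_polyW {w v : V} : v ∈ polyW w ↔ ∃ K, v ∈ polyWBelow w K :=
  Submodule.mem_iSup_of_directed _ (polyWBelow_mono w).directed_le

theorem zOrbit_le_polyW (w : V) : zOrbit w ≤ polyW w := le_iSup (polyWBelow w) 0

theorem polyWBelow_le_polyW (w : V) (K : ℕ) : polyWBelow w K ≤ polyW w := le_iSup _ K

theorem polyWBelow_succ_le {w : V} {K : ℕ} {P : Submodule ℂ V} (h : polyWBelow w K ≤ P)
    (hP : ∀ u ∈ polyWBelow w (K + 1), u ∈ P → ⁅W (-K), u⁆ ∈ P) : polyWBelow w (K + 1) ≤ P := by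
  have key : ∀ s, filt (polyWBelow w K) (fun _ : Unit => LieModule.toEnd ℂ Alg V (W (-K))) s ≤
      P := by
    intro s
    induction s with
    | zero => exact bot_le
    | succ s ih => exact filt_succ_le h fun _ u hu => hP u (mem_iSup_filt.2 ⟨s, hu⟩) (ih hu)
  exact iSup_le key

theorem lie_W_top_mem {w v : V} {K : ℕ} (hv : v ∈ polyWBelow w (K + 1)) :
    ⁅W (-K), v⁆ ∈ polyWBelow w (K + 1) :=
  apply_mem_iSup_filt hv ()

theorem lie_W_polyWBelow {w v : V} {K : ℕ} (k : ℕ) (hk : k < K) (hv : v ∈ polyWBelow w K) :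
    ⁅W (-k), v⁆ ∈ polyWBelow w K := by
  induction K generalizing v with
  | zero => omega
  | succ K ih =>
    rcases Nat.lt_succ_iff_lt_or_eq.1 hk with hk | rfl
    · suffices h : polyWBelow w (K + 1) ≤
          (polyWBelow w (K + 1)).comap (LieModule.toEnd ℂ Alg V (W (-k))) from h hv
      refine polyWBelow_succ_le (fun u hu => polyWBelow_mono w K.le_succ (ih hk hu)) ?_
      intro u _ hu
      change ⁅W (-k), ⁅W (-K), u⁆⁆ ∈ polyWBelow w (K + 1)
      rw [lie_W_comm]
      exact lie_W_top_mem hu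
    · exact lie_W_top_mem hv

theorem lie_z_polyW {w v : V} (hv : v ∈ polyW w) : ⁅z, v⁆ ∈ polyW w := by
  suffices h : ∀ K, polyWBelow w K ≤ (polyWBelow w K).comap (LieModule.toEnd ℂ Alg V z) by
    obtain ⟨K, hK⟩ := mem_polyW.1 hv
    exact mem_polyW.2 ⟨K, h K hK⟩
  intro K
  induction K with
  | zero => exact fun v hv => lie_z_mem_zOrbit hv
  | succ K ih =>
    refine polyWBelow_succ_le (ih.trans (Submodule.comap_mono (polyWBelow_mono w K.le_succ))) ?_
    intro u _ hu
    change ⁅z, ⁅W (-K), u⁆⁆ ∈ polyWBelow w (K + 1)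
    rw [← lie_z_comm]
    exact lie_W_top_mem hu

/-- The `W n` commute with each other, so the scalar by which `W n` acts on `S(z) w` propagates to
all of `polyW w`. -/
theorem lie_W_pos_polyW {w : V} (hw : w ∈ Wh φ V) {n : ℤ} (hn : 0 < n) {v : V}
    (hv : v ∈ polyW w) : ⁅W n, v⁆ = charW φ n • v := by
  suffices h : ∀ K, polyWBelow w K ≤
      LinearMap.ker (LieModule.toEnd ℂ Alg V (W n) - charW φ n • LinearMap.id) by
    obtain ⟨K, hK⟩ := mem_polyW.1 hv
    exact sub_eq_zero.1 (h K hK)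
  intro K
  induction K with
  | zero => exact fun v hv => sub_eq_zero.2 (lie_W_of_mem_Wh (zOrbit_le_Wh hw hv) hn)
  | succ K ih =>
    refine polyWBelow_succ_le ih fun u _ hu => ?_
    have hu' : ⁅W n, u⁆ = charW φ n • u := sub_eq_zero.1 hu
    refine sub_eq_zero.2 ?_
    change ⁅W n, ⁅W (-K), u⁆⁆ = charW φ n • ⁅W (-K), u⁆
    rw [lie_W_comm, hu', lie_smul]

theorem lie_W_polyW {w : V} (hw : w ∈ Wh φ V) (n : ℤ) {v : V} (hv : v ∈ polyW w) :
    ⁅W n, v⁆ ∈ polyW w := by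
  rcases lt_or_ge 0 n with hn | hn
  · rw [lie_W_pos_polyW hw hn hv]
    exact Submodule.smul_mem _ _ hv
  · obtain ⟨k, rfl⟩ : ∃ k : ℕ, n = -(k : ℤ) := ⟨n.natAbs, by omega⟩
    obtain ⟨K, hK⟩ := mem_polyW.1 hv
    exact mem_polyW.2 ⟨max K (k + 1), lie_W_polyWBelow k (by omega)
      (polyWBelow_mono w (le_max_left _ _) hK)⟩

theorem lie_spanW_mem {P : Submodule ℂ V} (hz : ∀ v ∈ P, ⁅z, v⁆ ∈ P)
    (hW : ∀ n, ∀ v ∈ P, ⁅W n, v⁆ ∈ P) {x : Alg} (hx : x ∈ spanW) {v : V} (hv : v ∈ P) :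
    ⁅x, v⁆ ∈ P := by
  induction hx using Submodule.span_induction with
  | zero => simp
  | add a b _ _ ha hb => rw [add_lie]; exact add_mem ha hb
  | smul t a _ ha => rw [smul_lie]; exact Submodule.smul_mem _ _ ha
  | mem a ha =>
    rcases ha with rfl | ⟨m, rfl⟩
    exacts [hz v hv, hW m v hv]

theorem lie_spanW_polyW {w : V} (hw : w ∈ Wh φ V) {x : Alg} (hx : x ∈ spanW) {v : V}
    (hv : v ∈ polyW w) : ⁅x, v⁆ ∈ polyW w :=
  lie_spanW_mem (fun _ => lie_z_polyW) (fun n _ => lie_W_polyW hw n) hx hv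

theorem lie_L_pos_polyW {w : V} (hw : w ∈ Wh φ V) {n : ℤ} (hn : 0 < n) {v : V}
    (hv : v ∈ polyW w) : ⁅L n, v⁆ ∈ polyW w := by
  suffices h : ∀ K, polyWBelow w K ≤ (polyW w).comap (LieModule.toEnd ℂ Alg V (L n)) by
    obtain ⟨K, hK⟩ := mem_polyW.1 hv
    exact h K hK
  intro K
  induction K with
  | zero =>
    intro v hv
    change ⁅L n, v⁆ ∈ polyW w
    rw [lie_L_of_mem_Wh (zOrbit_le_Wh hw hv) hn]
    exact Submodule.smul_mem _ _ (zOrbit_le_polyW w hv)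
  | succ K ih =>
    refine polyWBelow_succ_le ih fun u hu hu' => ?_
    change ⁅L n, ⁅W (-K), u⁆⁆ ∈ polyW w
    rw [leibniz_lie]
    exact add_mem (lie_spanW_polyW hw (lie_L_mem_spanW n (W_mem_spanW _))
      (polyWBelow_le_polyW w _ hu)) (lie_W_polyW hw _ hu')

theorem lie_L_lie_W_polyW {w : V} (hw : w ∈ Wh φ V) {n : ℤ} (k : ℕ) (hkn : (k : ℤ) < n) {v : V}
    (hv : v ∈ polyW w) :
    ⁅L n, ⁅W (-k), v⁆⁆ = ⁅W (-k), ⁅L n, v⁆⁆ - ((k + n : ℂ) * charW φ (n - k)) • v := by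
  rw [leibniz_lie, lie_LW, central, if_neg (by omega), add_zero, smul_lie,
    show -(k : ℤ) + n = n - k by ring, lie_W_pos_polyW hw (by omega) hv]
  push_cast
  module

/-- Moving `L n` past `W (-k)` with `k < K` produces a multiple of `W (n - k)`. Here `n - k ≥ 3`, so
it acts on `polyW w` by the scalar zero. -/
theorem lie_L_polyWBelow {w : V} (hw : w ∈ Wh φ V) {K : ℕ} {n : ℤ} (hn : (K : ℤ) + 2 ≤ n) {v : V}
    (hv : v ∈ polyWBelow w K) : ⁅L n, v⁆ = charL φ n • v := by
  suffices h : polyWBelow w K ≤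
      LinearMap.ker (LieModule.toEnd ℂ Alg V (L n) - charL φ n • LinearMap.id) from
    sub_eq_zero.1 (h hv)
  clear hv
  induction K with
  | zero => exact fun v hv => sub_eq_zero.2 (lie_L_of_mem_Wh (zOrbit_le_Wh hw hv) (by omega))
  | succ K ih =>
    refine polyWBelow_succ_le (ih (by push_cast at hn; omega)) fun u hu hu' => ?_
    have hu' : ⁅L n, u⁆ = charL φ n • u := sub_eq_zero.1 hu'
    refine sub_eq_zero.2 ?_
    change ⁅L n, ⁅W (-K), u⁆⁆ = charL φ n • ⁅W (-K), u⁆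
    push_cast at hn
    rw [lie_L_lie_W_polyW hw K (by omega) (polyWBelow_le_polyW w _ hu),
      charW_eq_zero φ (by omega), hu', lie_smul, mul_zero, zero_smul, sub_zero]

/-- The operator `L n - φ (L n)`. -/
def shiftL (φ : LieAlgebra.LieCharacter ℂ plus) (V : Type*) [AddCommGroup V] [Module ℂ V]
    [LieRingModule Alg V] [LieModule ℂ Alg V] (n : ℤ) : Module.End ℂ V :=
  LieModule.toEnd ℂ Alg V (L n) - charL φ n • LinearMap.id

/-- The operator `W n - φ (W n)`. -/
def shiftW (φ : LieAlgebra.LieCharacter ℂ plus) (V : Type*) [AddCommGroup V] [Module ℂ V]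
    [LieRingModule Alg V] [LieModule ℂ Alg V] (n : ℤ) : Module.End ℂ V :=
  LieModule.toEnd ℂ Alg V (W n) - charW φ n • LinearMap.id

theorem shiftL_apply (n : ℤ) (v : V) : shiftL φ V n v = ⁅L n, v⁆ - charL φ n • v := rfl

theorem shiftW_apply (n : ℤ) (v : V) : shiftW φ V n v = ⁅W n, v⁆ - charW φ n • v := rfl

theorem shiftL_polyWBelow {w : V} (hw : w ∈ Wh φ V) (K : ℕ) :
    ∀ v ∈ polyWBelow w K, shiftL φ V (K + 2) v = 0 := fun _ hv =>
  sub_eq_zero.2 (lie_L_polyWBelow hw le_rfl hv)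

/-- The index `K + 2` is chosen so that the bracket with `W (-K)` is a multiple of `W 2`, whose
scalar on `polyW w` is nonzero in the non-singular case. Together with `shiftL_polyWBelow`, this
makes the operator a multiple of the derivative with respect to the last variable `W (-K)`. -/
theorem shiftL_lie_W {w : V} (hw : w ∈ Wh φ V) (K : ℕ) : ∀ v ∈ polyWBelow w (K + 1),
    shiftL φ V (K + 2) (LieModule.toEnd ℂ Alg V (W (-K)) v) =
      LieModule.toEnd ℂ Alg V (W (-K)) (shiftL φ V (K + 2) v) +
        (-(2 * (K + 1 : ℂ) * charW φ 2)) • v := by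
  intro v hv
  simp only [shiftL_apply, LieModule.toEnd_apply_apply, lie_sub, lie_smul]
  rw [lie_L_lie_W_polyW hw K (by omega) (polyWBelow_le_polyW w _ hv),
    show (K : ℤ) + 2 - K = 2 by ring]
  push_cast
  module

theorem loweringConst_ne_zero (hφ : NonSingular φ) (K : ℕ) :
    -(2 * (K + 1 : ℂ) * charW φ 2) ≠ 0 :=
  neg_ne_zero.2 (mul_ne_zero (mul_ne_zero two_ne_zero (by exact_mod_cast K.succ_ne_zero))
    (charW_two_ne_zero φ hφ))

theorem mem_zOrbit_of_shiftL_eq_zero (hφ : NonSingular φ) {w : V} (hw : w ∈ Wh φ V) {v : V}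
    (hv : v ∈ polyW w) (h : ∀ n : ℤ, 0 < n → shiftL φ V n v = 0) : v ∈ zOrbit w := by
  obtain ⟨K, hK⟩ := mem_polyW.1 hv
  induction K with
  | zero => exact hK
  | succ K ih =>
    exact ih (mem_of_lower_eq_zero (loweringConst_ne_zero hφ K) (shiftL_polyWBelow hw K)
      (shiftL_lie_W hw K) hK (h _ (by omega)))

/-- A subspace that is stable under all `L n - φ (L n)`, `n > 0`, and meets `polyW w`
nontrivially, also meets `S(z) w` nontrivially. -/
theorem exists_ne_zero_mem_zOrbit (hφ : NonSingular φ) {w : V} (hw : w ∈ Wh φ V)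
    {N : Submodule ℂ V} (hN : ∀ n : ℤ, 0 < n → ∀ v ∈ N, shiftL φ V n v ∈ N) {v : V}
    (hv : v ∈ polyW w) (hvN : v ∈ N) (hv0 : v ≠ 0) : ∃ u ∈ zOrbit w, u ∈ N ∧ u ≠ 0 := by
  obtain ⟨K, hK⟩ := mem_polyW.1 hv
  clear hv
  induction K generalizing v with
  | zero => exact ⟨v, hK, hvN, hv0⟩
  | succ K ih =>
    obtain ⟨s, hs⟩ := mem_iSup_filt.1 hK
    induction s generalizing v with
    | zero => exact absurd hs hv0
    | succ s ihs =>
      -- Either `v` does not involve `W (-K)`, and the number of variables drops, or differentiating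
      -- gives a nonzero vector of `N` of lower degree in `W (-K)`.
      by_cases h0 : shiftL φ V (K + 2) v = 0
      · exact ih hvN hv0 (mem_of_lower_eq_zero (loweringConst_ne_zero hφ K)
          (shiftL_polyWBelow hw K) (shiftL_lie_W hw K) hK h0)
      · have h := lower_filt (shiftL_polyWBelow hw K) (shiftL_lie_W hw K) s v hs
        exact ihs (hN _ (by omega) v hvN) h0 (mem_iSup_filt.2 ⟨s, h⟩) h

end Modules

/-! ### Degree in the `L (-k)`, partial derivatives and the Euler operator. -/

section Modules

variable {φ : LieAlgebra.LieCharacter ℂ plus} {V : Type*} [AddCommGroup V] [Module ℂ V]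
  [LieRingModule Alg V] [LieModule ℂ Alg V]

/-- The sums of products of fewer than `s` of the `L (-k)`, `k ≥ 0`, applied to `polyW w`. -/
def degL (w : V) (s : ℕ) : Submodule ℂ V :=
  filt (polyW w) (fun k : ℕ => LieModule.toEnd ℂ Alg V (L (-k))) s

theorem degL_one (w : V) : degL w 1 = polyW w := filt_one

theorem degL_le_succ (w : V) (s : ℕ) : degL w s ≤ degL w (s + 1) := filt_le_succ s

theorem polyW_le_degL (w : V) (s : ℕ) : polyW w ≤ degL w (s + 1) := le_filt_succ s

theorem lie_L_mem_degL {w v : V} {s : ℕ} (hv : v ∈ degL w s) (k : ℕ) :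
    ⁅L (-k), v⁆ ∈ degL w (s + 1) :=
  apply_mem_filt_succ (X := fun k : ℕ => LieModule.toEnd ℂ Alg V (L (-k))) hv k

theorem degL_succ_le {w : V} {s : ℕ} {P : Submodule ℂ V} (hA : polyW w ≤ P)
    (h : ∀ k : ℕ, ∀ u ∈ degL w s, ⁅L (-k), u⁆ ∈ P) : degL w (s + 1) ≤ P :=
  filt_succ_le hA h

/-- Brackets of `L (-k)` with `spanW` stay in `spanW`, so moving `x` to the right past the `L (-k)`
never adds factors of type `L`. -/
theorem lie_spanW_degL {w : V} (hw : w ∈ Wh φ V) {x : Alg} (hx : x ∈ spanW) {s : ℕ} {v : V}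
    (hv : v ∈ degL w s) : ⁅x, v⁆ ∈ degL w s := by
  induction s generalizing x v with
  | zero =>
    obtain rfl : v = 0 := hv
    rw [lie_zero]
    exact zero_mem _
  | succ s ih =>
    suffices h : degL w (s + 1) ≤ (degL w (s + 1)).comap (LieModule.toEnd ℂ Alg V x) from h hv
    refine degL_succ_le (fun u hu => polyW_le_degL w s (lie_spanW_polyW hw hx hu)) ?_
    intro k u hu
    change ⁅x, ⁅L (-k), u⁆⁆ ∈ degL w (s + 1)
    rw [leibniz_lie, ← lie_skew]
    exact add_mem (degL_le_succ w s (ih (neg_mem (lie_L_mem_spanW _ hx)) hu))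
      (lie_L_mem_degL (ih hx hu) k)

theorem shiftW_lie_L (n : ℤ) (k : ℕ) (u : V) :
    shiftW φ V n ⁅L (-k), u⁆ = ⁅L (-k), shiftW φ V n u⁆ - ⁅⁅L (-k), W n⁆, u⁆ := by
  rw [shiftW_apply, shiftW_apply, lie_lie, lie_sub, lie_smul]
  abel

/-- `W n - φ (W n)` kills `polyW w`, and its commutator with `L (-k)` lies in `spanW`: one factor `L
(-k)` is consumed. -/
theorem shiftW_degL {w : V} (hw : w ∈ Wh φ V) {n : ℤ} (hn : 0 < n) {s : ℕ} {v : V}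
    (hv : v ∈ degL w (s + 1)) : shiftW φ V n v ∈ degL w s := by
  induction s generalizing v with
  | zero =>
    rw [zero_add, degL_one] at hv
    rw [shiftW_apply, lie_W_pos_polyW hw hn hv, sub_self]
    exact zero_mem _
  | succ s ih =>
    suffices h : degL w (s + 1 + 1) ≤ (degL w (s + 1)).comap (shiftW φ V n) from h hv
    refine degL_succ_le (fun u hu => ?_) fun k u hu => ?_
    · rw [Submodule.mem_comap, shiftW_apply, lie_W_pos_polyW hw hn hu, sub_self]
      exact zero_mem _
    · rw [Submodule.mem_comap, shiftW_lie_L]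
      exact sub_mem (lie_L_mem_degL (ih hu) k)
        (lie_spanW_degL hw (lie_L_mem_spanW _ (W_mem_spanW _)) hu)

/-- The bracket is a single `L (-(j + k))`, so the `L (-k)` commute modulo lower degree. A central
term could only occur for `j = k = 0`, where its coefficient is zero. -/
theorem lie_L_lie_L_degL {w : V} {s : ℕ} {u : V} (hu : u ∈ degL w s) (j k : ℕ) :
    ⁅L (-j), ⁅L (-k), u⁆⁆ - ⁅L (-k), ⁅L (-j), u⁆⁆ ∈ degL w (s + 1) := by
  have h : ⁅L (-j), L (-k)⁆ = ((j : ℂ) - k) • L (-((j + k : ℕ) : ℤ)) := by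
    rw [lie_LL, show -(k : ℤ) + -j = -((j + k : ℕ) : ℤ) by push_cast; ring, central]
    split_ifs with h
    · obtain rfl : j = 0 := by omega
      simp
    · push_cast
      module
  rw [leibniz_lie, add_sub_cancel_right, h, smul_lie]
  exact Submodule.smul_mem _ _ (lie_L_mem_degL hu _)

theorem lie_L_pos_degL {w : V} (hw : w ∈ Wh φ V) {n : ℤ} (hn : 0 < n) {s : ℕ} {v : V}
    (hv : v ∈ degL w s) : ⁅L n, v⁆ ∈ degL w s := by
  induction s generalizing n v with
  | zero =>
    obtain rfl : v = 0 := hv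
    rw [lie_zero]
    exact zero_mem _
  | succ s ih =>
    suffices h : degL w (s + 1) ≤ (degL w (s + 1)).comap (LieModule.toEnd ℂ Alg V (L n)) from h hv
    refine degL_succ_le (fun u hu => polyW_le_degL w s (lie_L_pos_polyW hw hn hu)) ?_
    intro k u hu
    change ⁅L n, ⁅L (-k), u⁆⁆ ∈ degL w (s + 1)
    rw [leibniz_lie, lie_LL, add_lie, smul_lie]
    refine add_mem (add_mem (Submodule.smul_mem _ _ ?_) (degL_le_succ w s
      (lie_spanW_degL hw (central_mem_spanW _ _) hu))) (lie_L_mem_degL (ih hn hu) k)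
    rcases lt_or_ge 0 (-(k : ℤ) + n) with h | h
    · exact degL_le_succ w s (ih h hu)
    · obtain ⟨m, hm⟩ : ∃ m : ℕ, -(k : ℤ) + n = -(m : ℤ) := ⟨(-(k : ℤ) + n).natAbs, by omega⟩
      rw [hm]
      exact lie_L_mem_degL hu m

theorem alg_induction {P : Submodule ℂ Alg} (hL : ∀ n, L n ∈ P) (hW : ∀ n, W n ∈ P)
    (hz : z ∈ P) (x : Alg) : x ∈ P := by
  have h : Submodule.span ℂ (Set.range basis) ≤ P := by
    rw [Submodule.span_le]
    rintro _ ⟨g, rfl⟩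
    cases g
    exacts [hL _, hW _, hz]
  exact h (basis.span_eq ▸ Submodule.mem_top)

theorem exists_mem_degL {w : V} (hw : IsCyclicWhittakerVector φ w) (v : V) :
    ∃ s, v ∈ degL w s := by
  have mem {v : V} : v ∈ (⨆ s, degL w s) ↔ ∃ s, v ∈ degL w s := mem_iSup_filt
  have stable : ∀ (x : Alg) (v : V), v ∈ (⨆ s, degL w s) → ⁅x, v⁆ ∈ ⨆ s, degL w s := by
    intro x v hv
    obtain ⟨s, hs⟩ := mem.1 hv
    have h := alg_induction (P := (degL w (s + 1)).comap
      ((LieModule.toEnd ℂ Alg V : Alg →ₗ[ℂ] Module.End ℂ V).flip v)) (fun n => ?_)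
      (fun n => degL_le_succ w s (lie_spanW_degL hw.1 (W_mem_spanW n) hs))
      (degL_le_succ w s (lie_spanW_degL hw.1 z_mem_spanW hs)) x
    · exact mem.2 ⟨s + 1, h⟩
    · change ⁅L n, v⁆ ∈ degL w (s + 1)
      rcases lt_or_ge 0 n with hn | hn
      · exact degL_le_succ w s (lie_L_pos_degL hw.1 hn hs)
      · obtain ⟨m, rfl⟩ : ∃ m : ℕ, n = -(m : ℤ) := ⟨n.natAbs, by omega⟩
        exact lie_L_mem_degL hs m
  let S : LieSubmodule ℂ Alg V := { (⨆ s, degL w s) with lie_mem := fun {x v} => stable x v }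
  have hS : LieSubmodule.lieSpan ℂ Alg {w} ≤ S :=
    LieSubmodule.lieSpan_le.2 (Set.singleton_subset_iff.2
      (mem.2 ⟨1, by rw [degL_one]; exact zOrbit_le_polyW w (self_mem_zOrbit w)⟩))
  rw [hw.2] at hS
  exact mem.1 (hS (LieSubmodule.mem_top v))

/-- Operators that act, modulo lower terms, as the partial derivatives with respect to
`L (-k)`, `k < K`, and vanish where all `W n - φ (W n)` do. -/
theorem exists_partialDeriv (hφ : NonSingular φ) {w : V} (hw : w ∈ Wh φ V) (K : ℕ) :
    ∃ d : ℕ → Module.End ℂ V,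
      (∀ k < K, ∀ s, ∀ v ∈ degL w (s + 1), d k v ∈ degL w s) ∧
      (∀ k < K, ∀ v, (∀ n : ℤ, 0 < n → shiftW φ V n v = 0) → d k v = 0) ∧
      (∀ k < K, ∀ j < K, ∀ s, ∀ u ∈ degL w (s + 1),
        d k ⁅L (-j), u⁆ - ⁅L (-j), d k u⁆ - (if k = j then u else 0) ∈ degL w s) := by
  -- Descending recursion on `k`: the derivative for `k` is built from those for all `i` with `k < i
  -- < K`.
  suffices H : ∀ m k, k < K → K ≤ k + m → ∃ d : Module.End ℂ V,
      (∀ s, ∀ v ∈ degL w (s + 1), d v ∈ degL w s) ∧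
      (∀ v, (∀ n : ℤ, 0 < n → shiftW φ V n v = 0) → d v = 0) ∧
      (∀ j < K, ∀ s, ∀ u ∈ degL w (s + 1),
        d ⁅L (-j), u⁆ - ⁅L (-j), d u⁆ - (if k = j then u else 0) ∈ degL w s) by
    have H' : ∀ k, ∃ d : Module.End ℂ V, k < K →
      (∀ s, ∀ v ∈ degL w (s + 1), d v ∈ degL w s) ∧
      (∀ v, (∀ n : ℤ, 0 < n → shiftW φ V n v = 0) → d v = 0) ∧
      (∀ j < K, ∀ s, ∀ u ∈ degL w (s + 1),
        d ⁅L (-j), u⁆ - ⁅L (-j), d u⁆ - (if k = j then u else 0) ∈ degL w s) := by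
      intro k
      by_cases hk : k < K
      · obtain ⟨d, hd⟩ := H K k hk (by omega)
        exact ⟨d, fun _ => hd⟩
      · exact ⟨0, fun h => absurd h hk⟩
    choose d hd using H'
    exact ⟨d, fun k hk => (hd k hk).1, fun k hk => (hd k hk).2.1, fun k hk => (hd k hk).2.2⟩
  intro m
  induction m with
  | zero => intro k hk hk'; omega
  | succ m ih =>
    intro k hk hkm
    have ih' : ∀ k', ∃ d : Module.End ℂ V, k < k' → k' < K →
      (∀ s, ∀ v ∈ degL w (s + 1), d v ∈ degL w s) ∧
      (∀ v, (∀ n : ℤ, 0 < n → shiftW φ V n v = 0) → d v = 0) ∧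
      (∀ j < K, ∀ s, ∀ u ∈ degL w (s + 1),
        d ⁅L (-j), u⁆ - ⁅L (-j), d u⁆ - (if k' = j then u else 0) ∈ degL w s) := by
      intro k'
      by_cases hk' : k < k' ∧ k' < K
      · obtain ⟨d, hd⟩ := ih k' hk'.2 (by omega)
        exact ⟨d, fun _ _ => hd⟩
      · exact ⟨0, fun h h' => absurd ⟨h, h'⟩ hk'⟩
    choose d hd using ih'
    set c : ℂ := -(2 * (k + 1 : ℂ) * charW φ 2) with hc
    have hc0 : c ≠ 0 := loweringConst_ne_zero hφ k
    let b : ℕ → Alg := fun i => ⁅L (-i), W (k + 2)⁆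
    have hb : ∀ i, b i ∈ spanW := fun i => lie_L_mem_spanW _ (W_mem_spanW _)
    -- The commutator of `W (k + 2)` with `L (-j)` is `-b j`. For `j > k` this need not be a scalar
    -- modulo lower degree, and the term `b j ∘ d j` cancels it. The `d i` act first, so `D` still
    -- kills what all the `W n - φ (W n)` kill.
    let D : Module.End ℂ V := shiftW φ V (k + 2) +
      ∑ i ∈ Finset.Ioo k K, LieModule.toEnd ℂ Alg V (b i) ∘ₗ d i
    have hD : ∀ v, D v = shiftW φ V (k + 2) v + ∑ i ∈ Finset.Ioo k K, ⁅b i, d i v⁆ := by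
      intro v
      simp [D]
    refine ⟨c⁻¹ • D, fun s v hv => ?_, fun v hv => ?_, fun j hj s u hu => ?_⟩
    · refine Submodule.smul_mem _ _ ?_
      rw [hD]
      refine add_mem (shiftW_degL hw (by omega) hv) (sum_mem fun i hi => ?_)
      rw [Finset.mem_Ioo] at hi
      exact lie_spanW_degL hw (hb i) ((hd i hi.1 hi.2).1 s v hv)
    · rw [LinearMap.smul_apply, hD, hv _ (by omega), zero_add, Finset.sum_eq_zero, smul_zero]
      intro i hi
      rw [Finset.mem_Ioo] at hi
      rw [(hd i hi.1 hi.2).2.1 v hv, lie_zero]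
    · have hsum : ∀ i ∈ Finset.Ioo k K,
          ⁅b i, d i ⁅L (-j), u⁆⁆ - ⁅L (-j), ⁅b i, d i u⁆⁆ - (if i = j then ⁅b j, u⁆ else 0)
            ∈ degL w s := by
        intro i hi
        rw [Finset.mem_Ioo] at hi
        have h1 := lie_spanW_degL hw (hb i) ((hd i hi.1 hi.2).2.2 j hj s u hu)
        have h2 := lie_spanW_degL hw (lie_L_mem_spanW (-j) (hb i)) ((hd i hi.1 hi.2).1 s u hu)
        convert sub_mem h1 h2 using 1
        have h3 : ⁅b i, if i = j then u else 0⁆ = if i = j then ⁅b j, u⁆ else 0 := by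
          split_ifs with h
          · rw [h]
          · rw [lie_zero]
        rw [lie_sub, lie_sub, h3, lie_lie (L (-j)) (b i)]
        abel
      -- For `j ≤ k`, `b j` is a multiple of `W (k + 2 - j)`, which acts as its `φ`-value modulo
      -- lower degree. That value is zero for `j < k`. For `j = k` it is `φ (W 2)`, with coefficient
      -- `2 (k + 1)`, so `b k` acts as `-c`.
      have hlast : ⁅b j, u⁆ - (if k < j then ⁅b j, u⁆ else 0) + (if k = j then c • u else 0)
          ∈ degL w s := by
        rcases lt_or_ge k j with hkj | hkj
        · rw [if_pos hkj, if_neg hkj.ne, sub_self, zero_add]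
          exact zero_mem _
        · have hbj : b j = ((k + 2 + j : ℂ)) • W (k + 2 - j) := by
            simp only [b]
            rw [lie_LW, central, if_neg (by omega), add_zero,
              show (k : ℤ) + 2 + -j = k + 2 - j by ring]
            push_cast
            module
          have h1 := Submodule.smul_mem _ (k + 2 + j : ℂ)
            (shiftW_degL hw (n := k + 2 - j) (by omega) hu)
          rw [if_neg (not_lt.2 hkj), sub_zero, hbj, smul_lie]
          rw [shiftW_apply] at h1
          rcases hkj.eq_or_lt with rfl | hkj
          · rw [if_pos rfl]
            convert h1 using 1
            rw [show (j : ℤ) + 2 - j = 2 by ring, hc]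
            module
          · rw [if_neg hkj.ne', add_zero]
            rwa [charW_eq_zero φ (by omega), zero_smul, sub_zero] at h1
      have htotal := sub_mem (sum_mem hsum) hlast
      have hfin := Submodule.smul_mem _ c⁻¹ htotal
      convert hfin using 1
      rw [LinearMap.smul_apply, LinearMap.smul_apply, lie_smul, hD, hD, shiftW_lie_L, lie_add]
      have e1 : (if k = j then u else 0) = c⁻¹ • (if k = j then c • u else 0) := by
        split_ifs
        · rw [smul_smul, inv_mul_cancel₀ hc0, one_smul]
        · rw [smul_zero]
      have e2 : ∑ i ∈ Finset.Ioo k K, (if i = j then ⁅b j, u⁆ else 0) =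
          if k < j then ⁅b j, u⁆ else 0 := by
        rw [Finset.sum_ite_eq' (Finset.Ioo k K) j fun _ => ⁅b j, u⁆]
        simp [hj]
      have e3 : ⁅⁅L (-j), W (k + 2)⁆, u⁆ = ⁅b j, u⁆ := rfl
      have e4 : ⁅L (-j), ∑ i ∈ Finset.Ioo k K, ⁅b i, d i u⁆⁆ =
          ∑ i ∈ Finset.Ioo k K, ⁅L (-j), ⁅b i, d i u⁆⁆ :=
        map_sum (LieModule.toEnd ℂ Alg V (L (-j))) _ _
      rw [e1, e3, e4, Finset.sum_sub_distrib, Finset.sum_sub_distrib, e2]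
      module

/-- Such a `v` is killed by all the partial derivatives, hence by the Euler operator `∑ L (-k) d k`.
This operator acts as `s` on top degree `s`, so the degree of `v` drops to zero. -/
theorem mem_polyW_of_shiftW_eq_zero (hφ : NonSingular φ) {w : V}
    (hw : IsCyclicWhittakerVector φ w) {v : V} (h : ∀ n : ℤ, 0 < n → shiftW φ V n v = 0) :
    v ∈ polyW w := by
  choose d hd1 hd2 hd3 using fun K => exists_partialDeriv hφ hw.1 K
  -- The operators `d K k` depend on the cutoff `K`, and `K` must exceed every index occurring in
  -- `u`. Requiring the identity for all large `K` makes the condition stable under sums.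
  have euler : ∀ s, ∀ u ∈ degL w (s + 1), ∃ K₀, ∀ K ≥ K₀,
      ∑ k ∈ Finset.range K, ⁅L (-k), d K k u⁆ - (s : ℂ) • u ∈ degL w s := by
    intro s
    induction s with
    | zero =>
      intro u hu
      refine ⟨0, fun K _ => ?_⟩
      rw [Nat.cast_zero, zero_smul, sub_zero]
      refine sum_mem fun k hk => ?_
      have h0 : d K k u = 0 := hd1 K k (Finset.mem_range.1 hk) 0 u hu
      rw [h0, lie_zero]
      exact zero_mem _
    | succ s ih =>
      let P : Submodule ℂ V :=
        { carrier := {u | ∃ K₀, ∀ K ≥ K₀,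
            ∑ k ∈ Finset.range K, ⁅L (-k), d K k u⁆ - ((s + 1 : ℕ) : ℂ) • u ∈ degL w (s + 1)}
          zero_mem' := ⟨0, fun K _ => by simp⟩
          add_mem' := by
            rintro u v ⟨K₁, h₁⟩ ⟨K₂, h₂⟩
            refine ⟨max K₁ K₂, fun K hK => ?_⟩
            convert add_mem (h₁ K (le_of_max_le_left hK)) (h₂ K (le_of_max_le_right hK)) using 1
            simp only [map_add, lie_add, Finset.sum_add_distrib, smul_add]
            abel
          smul_mem' := by
            rintro t u ⟨K₁, h₁⟩
            refine ⟨K₁, fun K hK => ?_⟩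
            convert Submodule.smul_mem _ t (h₁ K hK) using 1
            simp only [map_smul, lie_smul, smul_sub, Finset.smul_sum]
            rw [smul_comm t] }
      suffices hP : degL w (s + 1 + 1) ≤ P from fun u hu => hP hu
      refine degL_succ_le (fun u hu => ⟨0, fun K _ => ?_⟩) fun j u hu => ?_
      · refine sub_mem (sum_mem fun k hk => ?_) (Submodule.smul_mem _ _ (polyW_le_degL w s hu))
        have h0 : d K k u = 0 :=
          hd1 K k (Finset.mem_range.1 hk) 0 u (by rwa [zero_add, degL_one])
        rw [h0, lie_zero]
        exact zero_mem _
      · obtain ⟨K₀, hK₀⟩ := ih u hu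
        refine ⟨max K₀ (j + 1), fun K hK => ?_⟩
        have hj : j < K := by omega
        have h1 := lie_L_mem_degL (hK₀ K (by omega)) j
        have h2 : ∀ k ∈ Finset.range K, ⁅L (-k), d K k ⁅L (-j), u⁆⁆ -
            ⁅L (-j), ⁅L (-k), d K k u⁆⁆ - (if k = j then ⁅L (-j), u⁆ else 0) ∈ degL w (s + 1) := by
          intro k hk
          have hk := Finset.mem_range.1 hk
          have h3 := lie_L_mem_degL (hd3 K k hk j hj s u hu) k
          have h4 : ⁅L (-k), ⁅L (-j), d K k u⁆⁆ - ⁅L (-j), ⁅L (-k), d K k u⁆⁆ ∈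
            degL w (s + 1) := lie_L_lie_L_degL (hd1 K k hk s u hu) k j
          convert add_mem h3 h4 using 1
          have h5 : ⁅L (-k), if k = j then u else 0⁆ = if k = j then ⁅L (-j), u⁆ else 0 := by
            split_ifs with h
            · rw [h]
            · rw [lie_zero]
          rw [lie_sub, lie_sub, h5]
          abel
        convert add_mem (sum_mem h2) h1 using 1
        have e1 : ∑ k ∈ Finset.range K, (if k = j then ⁅L (-j), u⁆ else 0) = ⁅L (-j), u⁆ := by
          rw [Finset.sum_ite_eq' (Finset.range K) j fun _ => ⁅L (-j), u⁆]
          simp [hj]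
        have e2 : ⁅L (-j), ∑ k ∈ Finset.range K, ⁅L (-k), d K k u⁆⁆ =
            ∑ k ∈ Finset.range K, ⁅L (-j), ⁅L (-k), d K k u⁆⁆ :=
          map_sum (LieModule.toEnd ℂ Alg V (L (-j))) _ _
        rw [Finset.sum_sub_distrib, Finset.sum_sub_distrib, e1, lie_sub, e2, lie_smul]
        push_cast
        module
  have down : ∀ s, v ∈ degL w (s + 1) → v ∈ polyW w := by
    intro s
    induction s with
    | zero =>
      intro hv
      rwa [zero_add, degL_one] at hv
    | succ s ih =>
      intro hv
      apply ih
      obtain ⟨K, hK⟩ := euler _ v hv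
      have hK := hK K le_rfl
      rw [Finset.sum_eq_zero, zero_sub, neg_mem_iff] at hK
      · exact (Submodule.smul_mem_iff _ (by exact_mod_cast s.succ_ne_zero)).1 hK
      · intro k hk
        rw [hd2 K k (Finset.mem_range.1 hk) v h, lie_zero]
  obtain ⟨s, hs⟩ := exists_mem_degL hw v
  exact down s (degL_le_succ w s hs)

theorem Wh_eq_zOrbit (hφ : NonSingular φ) {w : V} (hw : IsCyclicWhittakerVector φ w) :
    Wh φ V = zOrbit w := by
  refine le_antisymm (fun v hv => ?_) (zOrbit_le_Wh hw.1)
  have hL : ∀ n : ℤ, 0 < n → shiftL φ V n v = 0 := fun n hn =>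
    sub_eq_zero.2 (lie_L_of_mem_Wh hv hn)
  have hW : ∀ n : ℤ, 0 < n → shiftW φ V n v = 0 := fun n hn =>
    sub_eq_zero.2 (lie_W_of_mem_Wh hv hn)
  exact mem_zOrbit_of_shiftL_eq_zero hφ hw.1 (mem_polyW_of_shiftW_eq_zero hφ hw hW) hL

/-- A submodule is stable under every `W n - φ (W n)` and `L n - φ (L n)`. Lowering a nonzero vector
while it stays nonzero ends first in `polyW w`, then in `S(z) w`. -/
theorem exists_zOrbit_mem_of_ne_bot (hφ : NonSingular φ) {w : V}
    (hw : IsCyclicWhittakerVector φ w) {N : LieSubmodule ℂ Alg V} (hN : N ≠ ⊥) :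
    ∃ u ∈ zOrbit w, u ∈ N ∧ u ≠ 0 := by
  have key : ∀ s, ∀ v ∈ degL w s, v ∈ N → v ≠ 0 → ∃ u ∈ polyW w, u ∈ N ∧ u ≠ 0 := by
    intro s
    induction s with
    | zero => exact fun v hv _ h0 => absurd hv h0
    | succ s ih =>
      intro v hv hvN h0
      by_cases h : ∀ n : ℤ, 0 < n → shiftW φ V n v = 0
      · exact ⟨v, mem_polyW_of_shiftW_eq_zero hφ hw h, hvN, h0⟩
      · push Not at h
        obtain ⟨n, hn, h⟩ := h
        exact ih _ (shiftW_degL hw.1 hn hv) (sub_mem (N.lie_mem hvN) (N.smul_mem _ hvN)) h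
  rw [Ne, LieSubmodule.eq_bot_iff] at hN
  push Not at hN
  obtain ⟨v, hvN, h0⟩ := hN
  obtain ⟨s, hs⟩ := exists_mem_degL hw v
  obtain ⟨u, hu, huN, hu0⟩ := key s v hs hvN h0
  exact exists_ne_zero_mem_zOrbit hφ hw.1 (N := N.toSubmodule)
    (fun n _ v hv => sub_mem (N.lie_mem hv) (N.smul_mem _ hv)) hu huN hu0

end Modules

/-! ### Polynomials in `z`: submodules and indecomposability. -/

open Polynomial

theorem isInternal_of_iSupIndep {ι V : Type*} [DecidableEq ι] [AddCommGroup V] [Module ℂ V]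
    [LieRingModule Alg V] {U : ι → LieSubmodule ℂ Alg V}
    (h : iSupIndep U) (h' : ⨆ i, U i = ⊤) : DirectSum.IsInternal U :=
  DirectSum.isInternal_submodule_of_iSupIndep_of_iSup_eq_top
    (LieSubmodule.iSupIndep_toSubmodule.2 h) (LieSubmodule.iSup_toSubmodule_eq_top.2 h')

section Modules

variable {φ : LieAlgebra.LieCharacter ℂ plus} {V : Type*} [AddCommGroup V] [Module ℂ V]
  [LieRingModule Alg V] [LieModule ℂ Alg V]

variable (V) in
/-- The action of `z` on `V`. -/
abbrev zAct : Module.End ℂ V := LieModule.toEnd ℂ Alg V z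

theorem aeval_z_mem (N : LieSubmodule ℂ Alg V) (p : ℂ[X]) {v : V} (hv : v ∈ N) :
    aeval (zAct V) p v ∈ N := by
  induction p using Polynomial.induction_on' with
  | add p q hp hq => rw [map_add, LinearMap.add_apply]; exact add_mem hp hq
  | monomial n a =>
    rw [aeval_monomial, Module.End.mul_apply, Module.algebraMap_end_apply]
    refine N.smul_mem a ?_
    induction n with
    | zero => simpa using hv
    | succ n ih =>
      rw [pow_succ', Module.End.mul_apply]
      exact N.lie_mem ih

theorem aeval_mul_z_mem (N : LieSubmodule ℂ Alg V) (p : ℂ[X]) {q : ℂ[X]} {v : V}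
    (hv : aeval (zAct V) q v ∈ N) : aeval (zAct V) (p * q) v ∈ N := by
  rw [map_mul, Module.End.mul_apply]
  exact aeval_z_mem N p hv

theorem mem_of_isCoprime (N : LieSubmodule ℂ Alg V) {p q : ℂ[X]} (hpq : IsCoprime p q) {v : V}
    (hp : aeval (zAct V) p v ∈ N) (hq : aeval (zAct V) q v ∈ N) : v ∈ N := by
  obtain ⟨a, b, hab⟩ := hpq
  have h := add_mem (aeval_mul_z_mem N a hp) (aeval_mul_z_mem N b hq)
  rwa [← LinearMap.add_apply, ← map_add, hab, map_one, Module.End.one_apply] at h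

theorem map_aeval_z {V' : Type*} [AddCommGroup V'] [Module ℂ V'] [LieRingModule Alg V']
    [LieModule ℂ Alg V'] (f : V →ₗ⁅ℂ, Alg⁆ V') (p : ℂ[X]) (v : V) :
    f (aeval (zAct V) p v) = aeval (zAct V') p (f v) := by
  induction p using Polynomial.induction_on' with
  | add p q hp hq => simp only [map_add, LinearMap.add_apply, hp, hq]
  | monomial n a =>
    simp only [aeval_monomial, Module.End.mul_apply, Module.algebraMap_end_apply, map_smul]
    congr 1
    induction n with
    | zero => simp
    | succ n ih =>
      rw [pow_succ', pow_succ', Module.End.mul_apply, Module.End.mul_apply, ← ih]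
      exact f.map_lie z _

theorem IsCyclicWhittakerVector.map {V' : Type*} [AddCommGroup V'] [Module ℂ V']
    [LieRingModule Alg V'] [LieModule ℂ Alg V'] {w : V} (hw : IsCyclicWhittakerVector φ w)
    (f : V →ₗ⁅ℂ, Alg⁆ V') (hf : Function.Surjective f) : IsCyclicWhittakerVector φ (f w) := by
  refine ⟨fun x => ?_, ?_⟩
  · rw [← f.map_lie, hw.1 x, map_smul]
  · have h : LieSubmodule.lieSpan ℂ Alg {w} ≤
        (LieSubmodule.lieSpan ℂ Alg {f w}).comap f :=
      LieSubmodule.lieSpan_le.2 (Set.singleton_subset_iff.2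
        (LieSubmodule.subset_lieSpan (Set.mem_singleton _)))
    rw [hw.2] at h
    refine eq_top_iff.2 fun y _ => ?_
    obtain ⟨x, rfl⟩ := hf y
    exact h (LieSubmodule.mem_top x)

/-- Every submodule of a Whittaker module is generated by some `p(z) w`. -/
theorem exists_eq_lieSpan (hφ : NonSingular φ) {w : V} (hw : IsCyclicWhittakerVector φ w)
    (N : LieSubmodule ℂ Alg V) : ∃ v ∈ zOrbit w, N = LieSubmodule.lieSpan ℂ Alg {v} := by
  let J : Ideal ℂ[X] :=
    { carrier := {p | aeval (zAct V) p w ∈ N}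
      zero_mem' := by simp
      add_mem' := fun {p q} hp hq => by
        simp only [Set.mem_ofPred_eq, map_add, LinearMap.add_apply] at hp hq ⊢
        exact add_mem hp hq
      smul_mem' := fun a p hp => aeval_mul_z_mem N a hp }
  obtain ⟨g, hg⟩ := IsPrincipalIdealRing.principal J
  have hgN : aeval (zAct V) g w ∈ N := by
    have h : g ∈ J := hg ▸ Submodule.mem_span_singleton_self g
    exact h
  refine ⟨aeval (zAct V) g w, ⟨g, rfl⟩, ?_⟩
  set N' := LieSubmodule.lieSpan ℂ Alg {aeval (zAct V) g w} with hN'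
  have hle : N' ≤ N := LieSubmodule.lieSpan_le.2 (Set.singleton_subset_iff.2 hgN)
  refine le_antisymm ?_ hle
  -- If `N` were larger than `N'`, its nonzero image in `V / N'`, again a cyclic Whittaker module,
  -- would contain a nonzero class of some `p(z) w`. Then `p ∈ J` is a multiple of `g`, so that
  -- class is zero.
  rw [← LieSubmodule.Quotient.map_mk'_eq_bot_le]
  by_contra hne
  obtain ⟨u, hu, huN, hu0⟩ := exists_zOrbit_mem_of_ne_bot hφ
    (hw.map (LieSubmodule.Quotient.mk' N') (LieSubmodule.Quotient.surjective_mk' N')) hne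
  obtain ⟨p, rfl⟩ := mem_zOrbit.1 hu
  obtain ⟨y, hy, hyu⟩ := (LieSubmodule.mem_map _).1 huN
  rw [← map_aeval_z] at hyu hu0
  have hsub : aeval (zAct V) p w - y ∈ N' := by
    rw [← LieSubmodule.Quotient.mk_eq_zero, map_sub, hyu, sub_self]
  have hpJ : p ∈ J := by
    have h := add_mem (hle hsub) hy
    rwa [sub_add_cancel] at h
  rw [hg] at hpJ
  obtain ⟨a, rfl⟩ := Submodule.mem_span_singleton.1 hpJ
  refine hu0 ((LieSubmodule.Quotient.mk_eq_zero N').2 (aeval_mul_z_mem N' a ?_))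
  exact LieSubmodule.subset_lieSpan (Set.mem_singleton _)

theorem isCyclicWhittakerVector_lieSpan {v : V} (hv : v ∈ Wh φ V) {N : LieSubmodule ℂ Alg V}
    (hN : N = LieSubmodule.lieSpan ℂ Alg {v}) (hvN : v ∈ N) :
    IsCyclicWhittakerVector φ (⟨v, hvN⟩ : N) := by
  refine ⟨fun x => Subtype.ext (hv x), eq_top_iff.2 fun y _ => ?_⟩
  have h : N ≤ (LieSubmodule.lieSpan ℂ Alg {(⟨v, hvN⟩ : N)}).map N.incl := by
    conv_lhs => rw [hN]
    exact LieSubmodule.lieSpan_le.2 (Set.singleton_subset_iff.2 ((LieSubmodule.mem_map _).2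
      ⟨⟨v, hvN⟩, LieSubmodule.subset_lieSpan (Set.mem_singleton _), rfl⟩))
  obtain ⟨y', hy', h'⟩ := (LieSubmodule.mem_map _).1 (h y.2)
  rwa [← Subtype.ext h']

theorem isWhittakerModule_submodule (hφ : NonSingular φ) {w : V}
    (hw : IsCyclicWhittakerVector φ w) (N : LieSubmodule ℂ Alg V) : IsWhittakerModule φ N := by
  obtain ⟨v, hv, hN⟩ := exists_eq_lieSpan hφ hw N
  have hvN : v ∈ N := hN ▸ LieSubmodule.subset_lieSpan (Set.mem_singleton _)
  exact ⟨⟨v, hvN⟩, isCyclicWhittakerVector_lieSpan (zOrbit_le_Wh hw.1 hv) hN hvN⟩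

theorem isIndecomposable_of_torsionFree (hφ : NonSingular φ) {w : V}
    (hw : IsCyclicWhittakerVector φ w)
    (h : ∀ p : ℂ[X], aeval (zAct V) p w = 0 → p = 0) : IsIndecomposable V := by
  refine ⟨⟨w, 0, fun h0 => one_ne_zero (h 1 (by rw [h0, map_zero]))⟩, fun A B hAB => ?_⟩
  obtain ⟨a, ha, hA⟩ := exists_eq_lieSpan hφ hw A
  obtain ⟨b, hb, hB⟩ := exists_eq_lieSpan hφ hw B
  obtain ⟨p, rfl⟩ := mem_zOrbit.1 ha
  obtain ⟨q, rfl⟩ := mem_zOrbit.1 hb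
  have hpA : aeval (zAct V) p w ∈ A := hA ▸ LieSubmodule.subset_lieSpan (Set.mem_singleton _)
  have hqB : aeval (zAct V) q w ∈ B := hB ▸ LieSubmodule.subset_lieSpan (Set.mem_singleton _)
  have hpq : aeval (zAct V) (p * q) w ∈ A ⊓ B :=
    ⟨mul_comm q p ▸ aeval_mul_z_mem A q hpA, aeval_mul_z_mem B p hqB⟩
  rw [hAB.inf_eq_bot, LieSubmodule.mem_bot] at hpq
  rcases mul_eq_zero.1 (h _ hpq) with rfl | rfl
  · left
    rw [hA, LieSubmodule.lieSpan_eq_bot_iff]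
    simp
  · right
    rw [hB, LieSubmodule.lieSpan_eq_bot_iff]
    simp

theorem isCoprime_X_sub_C_pow {p : ℂ[X]} {ξ : ℂ} (hp : p.eval ξ ≠ 0) (k : ℕ) :
    IsCoprime p ((X - C ξ) ^ k) :=
  (((irreducible_X_sub_C ξ).coprime_iff_not_dvd.2
    fun h => hp (dvd_iff_isRoot.1 h)).symm).pow_right

/-- In a decomposition the components of `w` are again Whittaker vectors, hence of the form `p(z) w`
and `(1 - p)(z) w`. One of `p`, `1 - p` is nonzero at `ξ`, so it is invertible modulo `(X - ξ)^k`,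
and its summand contains `w`. -/
theorem isIndecomposable_of_pow_eq_zero (hφ : NonSingular φ) {w : V}
    (hw : IsCyclicWhittakerVector φ w) (hw0 : w ≠ 0) {ξ : ℂ} {k : ℕ}
    (h : aeval (zAct V) ((X - C ξ) ^ k) w = 0) : IsIndecomposable V := by
  have unit_mem : ∀ (N : LieSubmodule ℂ Alg V) (p : ℂ[X]), p.eval ξ ≠ 0 →
      aeval (zAct V) p w ∈ N → w ∈ N := fun N p hp hpN =>
    mem_of_isCoprime N (isCoprime_X_sub_C_pow hp k) hpN (h ▸ N.zero_mem)
  have eq_top : ∀ N : LieSubmodule ℂ Alg V, w ∈ N → N = ⊤ := fun N hN =>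
    eq_top_iff.2 (hw.2 ▸ LieSubmodule.lieSpan_le.2 (Set.singleton_subset_iff.2 hN))
  refine ⟨⟨w, 0, hw0⟩, fun A B hAB => ?_⟩
  obtain ⟨a, ha, b, hb, hab⟩ : ∃ a ∈ A, ∃ b ∈ B, a + b = w := by
    rw [← LieSubmodule.mem_sup, hAB.sup_eq_top]
    exact LieSubmodule.mem_top w
  -- This vector lies in `A`, and also in `B`, because it is minus the corresponding vector for `b`.
  have hcomp : ∀ x : plus, ⁅(x : Alg), a⁆ - φ x • a = 0 := by
    intro x
    have hx := hw.1 x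
    rw [← hab, lie_add, smul_add] at hx
    have hxB : ⁅(x : Alg), a⁆ - φ x • a = -(⁅(x : Alg), b⁆ - φ x • b) := by
      rw [eq_neg_iff_add_eq_zero, ← sub_eq_zero.2 hx]
      abel
    rw [← LieSubmodule.mem_bot (R := ℂ) (L := Alg), ← hAB.inf_eq_bot]
    refine ⟨sub_mem (A.lie_mem ha) (A.smul_mem _ ha), ?_⟩
    change _ ∈ B
    rw [hxB]
    exact neg_mem (sub_mem (B.lie_mem hb) (B.smul_mem _ hb))
  have haWh : a ∈ Wh φ V := fun x => sub_eq_zero.1 (hcomp x)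
  rw [Wh_eq_zOrbit hφ hw] at haWh
  obtain ⟨p, rfl⟩ := mem_zOrbit.1 haWh
  have hb' : aeval (zAct V) (1 - p) w = b := by
    rw [map_sub, map_one, LinearMap.sub_apply, Module.End.one_apply, sub_eq_iff_eq_add', hab]
  by_cases hp : p.eval ξ = 0
  · left
    have hB := eq_top B (unit_mem B (1 - p) (by simp [hp]) (hb'.symm ▸ hb))
    rw [← hAB.inf_eq_bot, hB, inf_top_eq]
  · right
    have hA := eq_top A (unit_mem A p hp ha)
    rw [← hAB.inf_eq_bot, hA, top_inf_eq]

/-! ### Generalized eigenspaces of `z` and the decomposition. -/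

variable (V) in
/-- The submodule of the vectors that are killed by some power of `z - ξ`. -/
def genEigen (ξ : ℂ) : LieSubmodule ℂ Alg V where
  toSubmodule := (zAct V).maxGenEigenspace ξ
  lie_mem {x v} hv := by
    obtain ⟨k, hk⟩ := ((zAct V).mem_maxGenEigenspace ξ v).1 hv
    refine ((zAct V).mem_maxGenEigenspace ξ _).2 ⟨k, ?_⟩
    have h : ((zAct V) - ξ • 1) ^ k = aeval (zAct V) ((X - C ξ) ^ k) := by
      simp [Algebra.algebraMap_eq_smul_one]
    rw [h] at hk ⊢
    rw [← lie_aeval_z, hk, lie_zero]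

theorem mem_genEigen {ξ : ℂ} {v : V} :
    v ∈ genEigen V ξ ↔ ∃ k, aeval (zAct V) ((X - C ξ) ^ k) v = 0 := by
  have h (k : ℕ) : ((zAct V) - ξ • 1) ^ k = aeval (zAct V) ((X - C ξ) ^ k) := by
    simp [Algebra.algebraMap_eq_smul_one]
  simp_rw [← h]
  exact (zAct V).mem_maxGenEigenspace ξ v

theorem mem_iSup_genEigen (S : Finset ℂ) (n : ℂ → ℕ) {v : V}
    (hv : aeval (zAct V) (∏ ξ ∈ S, (X - C ξ) ^ n ξ) v = 0) : v ∈ ⨆ ξ ∈ S, genEigen V ξ := by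
  induction S using Finset.induction_on generalizing v with
  | empty =>
    rw [Finset.prod_empty, map_one, Module.End.one_apply] at hv
    rw [hv]
    exact zero_mem _
  | insert ξ S hξ ih =>
    rw [Finset.prod_insert hξ] at hv
    have hcop : IsCoprime (∏ η ∈ S, (X - C η) ^ n η) ((X - C ξ) ^ n ξ) := by
      refine isCoprime_X_sub_C_pow ?_ _
      rw [eval_prod, Finset.prod_ne_zero_iff]
      intro η hη
      rw [eval_pow, eval_sub, eval_X, eval_C]
      exact pow_ne_zero _ (sub_ne_zero.2 fun h => hξ (h ▸ hη))
    rw [Finset.iSup_insert]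
    -- The product over `S` sends `v` into the eigenspace of `ξ`, and `(z - ξ)^n` sends it into the
    -- sum of the others. By Bézout `v` lies in the sum of both.
    refine mem_of_isCoprime _ hcop ?_ ?_
    · refine le_sup_left (a := genEigen V ξ) (mem_genEigen.2 ⟨n ξ, ?_⟩)
      rwa [← Module.End.mul_apply, ← map_mul]
    · refine le_sup_right (a := genEigen V ξ) (ih ?_)
      rwa [← Module.End.mul_apply, ← map_mul, mul_comm]

theorem iSupIndep_genEigen : iSupIndep (genEigen V) :=
  LieSubmodule.iSupIndep_toSubmodule.1 (zAct V).independent_maxGenEigenspace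

theorem exists_isInternal (hφ : NonSingular φ) {w : V} (hw : IsCyclicWhittakerVector φ w) :
    ∃ (r : ℕ) (U : Fin r → LieSubmodule ℂ Alg V),
      (∀ i, IsIndecomposable (U i) ∧ IsWhittakerModule φ (U i)) ∧ DirectSum.IsInternal U := by
  by_cases h : ∀ p : ℂ[X], aeval (zAct V) p w = 0 → p = 0
  · refine ⟨1, fun _ => ⊤, fun _ => ⟨?_, isWhittakerModule_submodule hφ hw ⊤⟩, ?_⟩
    · refine isIndecomposable_of_torsionFree hφ
        (isCyclicWhittakerVector_lieSpan hw.1 hw.2.symm (LieSubmodule.mem_top w)) fun p hp => ?_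
      refine h p ?_
      have h' := map_aeval_z (⊤ : LieSubmodule ℂ Alg V).incl p ⟨w, LieSubmodule.mem_top w⟩
      rw [hp, map_zero] at h'
      exact h'.symm
    · exact isInternal_of_iSupIndep (iSupIndep_subsingleton _) (iSup_const)
  · push Not at h
    obtain ⟨p, hpw, hp0⟩ := h
    classical
    -- The polynomial `p` need not be minimal, so some roots may give the zero eigenspace, which is
    -- not indecomposable. For `V = 0` this leaves `S` empty and `r = 0`.
    let S : Finset ℂ := p.roots.toFinset.filter fun ξ => genEigen V ξ ≠ ⊥
    have hmem : w ∈ ⨆ ξ ∈ p.roots.toFinset, genEigen V ξ := by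
      refine mem_iSup_genEigen _ (fun ξ => p.roots.count ξ) ?_
      rw [← Finset.prod_multiset_map_count]
      have hfac := (IsAlgClosed.splits p).eq_prod_roots
      rw [hfac, map_mul, Module.End.mul_apply, aeval_C, Module.algebraMap_end_apply] at hpw
      exact (smul_eq_zero.1 hpw).resolve_left (leadingCoeff_ne_zero.2 hp0)
    have htop : ⨆ i : S, genEigen V (i : ℂ) = ⊤ := by
      refine eq_top_iff.2 (hw.2 ▸ LieSubmodule.lieSpan_le.2 (Set.singleton_subset_iff.2 ?_))
      refine (iSup₂_le fun ξ hξ => ?_ :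
        ⨆ ξ ∈ p.roots.toFinset, genEigen V ξ ≤ ⨆ i : S, genEigen V (i : ℂ)) hmem
      by_cases h0 : genEigen V ξ = ⊥
      · rw [h0]
        exact bot_le
      · exact le_iSup (fun i : S => genEigen V (i : ℂ)) ⟨ξ, Finset.mem_filter.2 ⟨hξ, h0⟩⟩
    refine ⟨S.card, fun i => genEigen V (S.equivFin.symm i : ℂ), fun i => ?_, ?_⟩
    · have hne : genEigen V (S.equivFin.symm i : ℂ) ≠ ⊥ :=
        (Finset.mem_filter.1 (S.equivFin.symm i).2).2
      obtain ⟨u, hu⟩ := isWhittakerModule_submodule hφ hw (genEigen V (S.equivFin.symm i : ℂ))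
      refine ⟨?_, u, hu⟩
      obtain ⟨k, hk⟩ := mem_genEigen.1 u.2
      refine isIndecomposable_of_pow_eq_zero hφ hu ?_ (ξ := (S.equivFin.symm i : ℂ)) (k := k) ?_
      · rintro rfl
        have hbot : (⊥ : LieSubmodule ℂ Alg (genEigen V (S.equivFin.symm i : ℂ))) = ⊤ := by
          rw [← hu.2, eq_comm, LieSubmodule.lieSpan_eq_bot_iff]
          simp
        refine hne ((LieSubmodule.eq_bot_iff _).2 fun m hm => ?_)
        have hm' : (⟨m, hm⟩ : genEigen V (S.equivFin.symm i : ℂ)) ∈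
            (⊥ : LieSubmodule ℂ Alg (genEigen V (S.equivFin.symm i : ℂ))) :=
          hbot ▸ LieSubmodule.mem_top _
        exact congrArg Subtype.val ((LieSubmodule.mem_bot _).1 hm')
      · refine Subtype.ext ?_
        exact (map_aeval_z (genEigen V (S.equivFin.symm i : ℂ)).incl _ u).trans hk
    · refine isInternal_of_iSupIndep ?_ ?_
      · exact (iSupIndep_genEigen (V := V)).comp
          (Subtype.val_injective.comp S.equivFin.symm.injective)
      · rw [← htop]
        exact S.equivFin.symm.iSup_comp (g := fun i : S => genEigen V (i : ℂ))

end Modules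

end W22

end

theorem corollary5p3p2 (φ : LieAlgebra.LieCharacter ℂ W22.plus) (hφ : W22.NonSingular φ)
    (V : Type*) [AddCommGroup V] [Module ℂ V] [LieRingModule W22.Alg V] [LieModule ℂ W22.Alg V]
    (hV : W22.IsWhittakerModule φ V) :
    (∃ (r : ℕ) (U : Fin r → LieSubmodule ℂ W22.Alg V),
      (∀ i, W22.IsIndecomposable (U i) ∧ W22.IsWhittakerModule φ (U i)) ∧
      DirectSum.IsInternal U) ∧
    (∀ w : V, W22.IsCyclicWhittakerVector φ w →
      (W22.Wh φ V : Set V) = W22.polyOrbit w ∧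
      ∀ N : LieSubmodule ℂ W22.Alg V, W22.IsWhittakerModule φ N ∧
        ∃ v ∈ W22.Wh φ V, N = LieSubmodule.lieSpan ℂ W22.Alg {v}) := by
  refine ⟨?_, fun w hw => ⟨?_, fun N => ⟨W22.isWhittakerModule_submodule hφ hw N, ?_⟩⟩⟩
  · obtain ⟨w, hw⟩ := hV
    exact W22.exists_isInternal hφ hw
  · rw [W22.Wh_eq_zOrbit hφ hw, W22.coe_zOrbit]
  · obtain ⟨v, hv, hN⟩ := W22.exists_eq_lieSpan hφ hw N
    exact ⟨v, W22.zOrbit_le_Wh hw.1 hv, hN⟩
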